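/- Let $H,d,N\in\mathbb{N}$, let $\ell:\mathbb{R}\times\mathbb{R}\to\mathbb{R}$ be continuously differentiable with locally Lipschitz gradient, let $x_1,\dots,x_N\in\mathbb{R}^d\setminus\{0\}$ and $y_1,\dots,y_N\in\mathbb{R}$, write $\ell_i=\ell(\cdot,y_i)$, and let \[ L(u_1,w_1,\dots,u_H,w_H)=\sum_{i=1}^N \ell_i\Big(\sum_{k=1}^H u_k\max\{w_k^\top x_i,0\}\Big),\qquad u_k\in\mathbb{R},\ w_k\in\mathbb{R}^d . \] For a locally Lipschitz, directionally differentiable function $f$ on a Euclidean space, the Fréchet subdifferential is $\widehat\partial f(z)=\{s: s^\top v\le f'(z;v)\text{ for all }v\}$, and the limiting (Mordukhovich) subdifferential is $\partial f(z)=\{s:\exists\, z_\nu\to z,\ s_\nu\to s,\ s_\nu\in\widehat\partial f(z_\nu)\text{ for all }\nu\}$. Fix a point $(u_1,w_1,\dots,u_H,w_H)$ and put $\rho_i=\ell_i'\big(\sum_{k} u_k\max\{w_k^\top x_i,0\}\big)$. For each $k$ let $I_k^+$, $I_k^{>}$, $I_k^-$ be the sets of those $i$ with $w_k^\top x_i=0$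 and, respectively, $u_k\rho_i\ge 0$, $u_k\rho_i>0$, $u_k\rho_i<0$; and let $G_k^L$ be the Minkowski sum \[ \sum_{i\notin I_k^+\cup I_k^-}u_k\rho_i\mathbf 1_{w_k^\top x_i>0}\,x_i+\sum_{j\in I_k^+}u_k\rho_j x_j\cdot[0,1]+\Big\{\sum_{j\in I_k^-}u_k\rho_j\mathbf 1_{v^\top x_j>0}\,x_j:\ v\in\mathbb{R}^d,\ x_t^\top v\ne0\ \ \forall t\in I_k^-\Big\}. \] Consider the exact limiting chain rule at this point, \[ \partial L(u_1,w_1,\dots,u_H,w_H)=\prod_{k=1}^H\Big\{\sum_{i=1}^N\rho_i\max\{w_k^\top x_i,0\}\Big\}\times G_k^L. \tag{CR} \] Then: 1. (CR) holds if and only if $\operatorname{span}\{x_i\}_{i\in I_k^{>}}\cap\operatorname{span}\{x_j\}_{j\in I_k^-}=\{0\}$ for every $k$. 2. In particular, (CR) holds whenever the Span Qualification (SQ) holds, that is, $\operatorname{span}\{x_i\}_{i\in I_k^{+}}\cap\operatorname{span}\{x_j\}_{j\in I_k^-}=\{0\}$ for every $k$. 3. If $\rho_i\neq0$ for all $i,k$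 with $u_k\ne0$ and $w_k^\top x_i=0$, then (CR) holds if and only if SQ holds. -/

import Mathlib

open Filter Topology

noncomputable section

/-- `l` is the one-sided directional derivative `f'(x; v) = lim_{t ↓ 0} (f (x + t v) - f x) / t`. -/
def HasDirDeriv {E : Type*} [NormedAddCommGroup E] [InnerProductSpace ℝ E]
    (f : E → ℝ) (x v : E) (l : ℝ) : Prop :=
  Tendsto (fun t : ℝ => (f (x + t • v) - f x) / t) (𝓝[>] 0) (𝓝 l)

/-- Fréchet subdifferential (through directional derivatives): all `s` with
`⟪s, v⟫ ≤ f'(x; v)` for every direction `v`; it is empty if some directional derivative at `x`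
does not exist. -/
def frechetSubdiff {E : Type*} [NormedAddCommGroup E] [InnerProductSpace ℝ E]
    (f : E → ℝ) (x : E) : Set E :=
  {s | ∀ v : E, ∃ l : ℝ, HasDirDeriv f x v l ∧ inner ℝ s v ≤ l}

/-- Limiting (Mordukhovich) subdifferential: the Kuratowski outer limit of the Fréchet
subdifferentials at points tending to `x`. -/
def limitingSubdiff {E : Type*} [NormedAddCommGroup E] [InnerProductSpace ℝ E]
    (f : E → ℝ) (x : E) : Set E :=
  {s | ∃ (z : ℕ → E) (g : ℕ → E), Tendsto z atTop (𝓝 x) ∧ Tendsto g atTop (𝓝 s) ∧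
    ∀ n, g n ∈ frechetSubdiff f (z n)}

/-- Parameters `(u₁, w₁, …, u_H, w_H)` of the network, the space `(ℝ × ℝᵈ)^H` with its standard
inner product; `u_k = (p k).fst` and `w_k = (p k).snd`. -/
abbrev Params (H d : ℕ) : Type :=
  PiLp 2 (fun _ : Fin H => WithLp 2 (ℝ × EuclideanSpace ℝ (Fin d)))

/-- Network output `∑ k, u_k * max (w_kᵀ a) 0` on the input `a`. -/
def netOut {H d : ℕ} (p : Params H d) (a : EuclideanSpace ℝ (Fin d)) : ℝ :=
  ∑ k, (p k).fst * max (inner ℝ (p k).snd a) 0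

/-- Empirical loss `L(u₁, w₁, …, u_H, w_H)`. -/
def empLoss {H d N : ℕ} (ℓ : ℝ → ℝ → ℝ) (x : Fin N → EuclideanSpace ℝ (Fin d)) (y : Fin N → ℝ)
    (p : Params H d) : ℝ :=
  ∑ i, ℓ (netOut p (x i)) (y i)

/-- `ρ_i = ℓ_i'(∑ k, u_k * max (w_kᵀ x_i) 0)`, where `ℓ_i = ℓ(·, y_i)`. -/
def rho {H d N : ℕ} (ℓ : ℝ → ℝ → ℝ) (x : Fin N → EuclideanSpace ℝ (Fin d)) (y : Fin N → ℝ)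
    (p : Params H d) (i : Fin N) : ℝ :=
  deriv (fun t : ℝ => ℓ t (y i)) (netOut p (x i))

open Classical in
/-- `I_k^+ = {i | w_kᵀ x_i = 0, u_k ρ_i ≥ 0}`. -/
def idxPlus {H d N : ℕ} (ℓ : ℝ → ℝ → ℝ) (x : Fin N → EuclideanSpace ℝ (Fin d)) (y : Fin N → ℝ)
    (p : Params H d) (k : Fin H) : Finset (Fin N) :=
  Finset.univ.filter fun i => inner ℝ (p k).snd (x i) = 0 ∧ 0 ≤ (p k).fst * rho ℓ x y p i

open Classical in
/-- `I_k^{>} = {i | w_kᵀ x_i = 0, u_k ρ_i > 0}`, the indices in `I_k^+` of nonzero weight. -/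
def idxPos {H d N : ℕ} (ℓ : ℝ → ℝ → ℝ) (x : Fin N → EuclideanSpace ℝ (Fin d)) (y : Fin N → ℝ)
    (p : Params H d) (k : Fin H) : Finset (Fin N) :=
  Finset.univ.filter fun i => inner ℝ (p k).snd (x i) = 0 ∧ 0 < (p k).fst * rho ℓ x y p i

open Classical in
/-- `I_k^- = {i | w_kᵀ x_i = 0, u_k ρ_i < 0}`. -/
def idxMinus {H d N : ℕ} (ℓ : ℝ → ℝ → ℝ) (x : Fin N → EuclideanSpace ℝ (Fin d)) (y : Fin N → ℝ)
    (p : Params H d) (k : Fin H) : Finset (Fin N) :=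
  Finset.univ.filter fun i => inner ℝ (p k).snd (x i) = 0 ∧ (p k).fst * rho ℓ x y p i < 0

open Classical in
/-- The set `G_k^L`: the Minkowski sum of a point (indices off the kink), the segments
`u_k ρ_j x_j [0,1]` for `j ∈ I_k^+`, and the finite set of sign-pattern sums over `I_k^-`
given by the directions `v` with `x_tᵀ v ≠ 0` for all `t ∈ I_k^-`. -/
def limitingG {H d N : ℕ} (ℓ : ℝ → ℝ → ℝ) (x : Fin N → EuclideanSpace ℝ (Fin d)) (y : Fin N → ℝ)
    (p : Params H d) (k : Fin H) : Set (EuclideanSpace ℝ (Fin d)) :=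
  {g | ∃ (ξ : Fin N → ℝ) (v : EuclideanSpace ℝ (Fin d)),
    (∀ j, ξ j ∈ Set.Icc (0 : ℝ) 1) ∧
    (∀ t ∈ idxMinus ℓ x y p k, 0 < |inner ℝ (x t) v|) ∧
    g = (∑ i ∈ (idxPlus ℓ x y p k ∪ idxMinus ℓ x y p k)ᶜ,
            ((p k).fst * rho ℓ x y p i * (if 0 < inner ℝ (p k).snd (x i) then 1 else 0)) • x i)
        + (∑ j ∈ idxPlus ℓ x y p k, ((p k).fst * rho ℓ x y p j * ξ j) • x j)
        + ∑ j ∈ idxMinus ℓ x y p k,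
            ((p k).fst * rho ℓ x y p j * (if 0 < inner ℝ v (x j) then 1 else 0)) • x j}

/-- The product `∏ k, {∑ i, ρ_i * max (w_kᵀ x_i) 0} × G_k^L`. -/
def chainSet {H d N : ℕ} (ℓ : ℝ → ℝ → ℝ) (x : Fin N → EuclideanSpace ℝ (Fin d)) (y : Fin N → ℝ)
    (p : Params H d) : Set (Params H d) :=
  {g | ∀ k, (g k).fst = ∑ i, rho ℓ x y p i * max (inner ℝ (p k).snd (x i)) 0 ∧
    (g k).snd ∈ limitingG ℓ x y p k}

/-- The exact limiting chain rule for the empirical loss at `p`. -/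
def LimitingChainRule {H d N : ℕ} (ℓ : ℝ → ℝ → ℝ) (x : Fin N → EuclideanSpace ℝ (Fin d))
    (y : Fin N → ℝ) (p : Params H d) : Prop :=
  limitingSubdiff (empLoss ℓ x y) p = chainSet ℓ x y p

/-- Span Qualification with the index sets `I_k^+`, `I_k^-`:
`span {x_i | i ∈ I_k^+} ∩ span {x_j | j ∈ I_k^-} = {0}` for every `k`. -/
def SpanQual {H d N : ℕ} (ℓ : ℝ → ℝ → ℝ) (x : Fin N → EuclideanSpace ℝ (Fin d)) (y : Fin N → ℝ)
    (p : Params H d) : Prop :=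
  ∀ k, Submodule.span ℝ (x '' (idxPlus ℓ x y p k : Set (Fin N))) ⊓
    Submodule.span ℝ (x '' (idxMinus ℓ x y p k : Set (Fin N))) = ⊥

/-- Span Qualification restricted to the data points that carry a nonzero weight `u_k ρ_i`:
`span {x_i | i ∈ I_k^{>}} ∩ span {x_j | j ∈ I_k^-} = {0}` for every `k`. -/
def ActiveSpanQual {H d N : ℕ} (ℓ : ℝ → ℝ → ℝ) (x : Fin N → EuclideanSpace ℝ (Fin d))
    (y : Fin N → ℝ) (p : Params H d) : Prop :=
  ∀ k, Submodule.span ℝ (x '' (idxPos ℓ x y p k : Set (Fin N))) ⊓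
    Submodule.span ℝ (x '' (idxMinus ℓ x y p k : Set (Fin N))) = ⊥

end

/-! Write `β_i = u_k ρ_i`. The Fréchet subdifferential splits neuron by neuron
(`mem_frechetSubdiff_empLoss_iff`): the `u_k` part is forced, and the `w_k` part consists of the
vectors dominated by a `β`-weighted sum of one-sided ramp derivatives. Since there are finitely many
sign patterns, a limiting subgradient is dominated by such a sum at the limit weights, with the
pattern of some nearby `w` (`exists_weight_of_mem_limitingSubdiff`).

Suppose the spans over `I_k^>` and `I_k^-` meet trivially. If `w` lay on a kink from `I_k^-`, then
testing with `±v`, for a generic `v` orthogonal to the points of `I_k^>`, would bound zero by a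
negative number. So all kinks of `w` carry nonnegative weights, and separation from a zonotope
produces the multipliers in `[0,1]`. Conversely, every sign pattern over `I_k^-` is realized by a
direction that stays on the kinks of `I_k^>`. Moving along it changes the weights `β_i`, and those
that vanish may turn negative; their kinks lie in the span of the positively weighted ones, which
absorb the error (`exists_tendsto_subgradient`).

If the spans meet, the Gram-type operators of the two families agree up to a positive factor at some
`v` (`exists_sum_inner_smul_eq`). An element of the chain set that is extremal against a generic
perturbation of `v` would, as a limiting subgradient, come from a `w` with signs agreeing with `v`
on `I_k^>` and opposite on `I_k^-`. Pairing the operator identity with `w` then equates a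
nonnegative number with a negative one. -/

/-- The one-sided directional derivative of `r ↦ max r 0` at `r` in direction `q`. -/
noncomputable def reluDir (r q : ℝ) : ℝ := if 0 < r then q else if r < 0 then 0 else max q 0

theorem reluDir_of_pos {r : ℝ} (h : 0 < r) (q : ℝ) : reluDir r q = q := by simp [reluDir, h]

theorem reluDir_of_neg {r : ℝ} (h : r < 0) (q : ℝ) : reluDir r q = 0 := by
  simp [reluDir, h, h.le.not_gt]

@[simp] theorem reluDir_zero_left (q : ℝ) : reluDir 0 q = max q 0 := by simp [reluDir]

@[simp] theorem reluDir_zero_right (r : ℝ) : reluDir r 0 = 0 := by simp [reluDir]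

theorem reluDir_of_ne {r : ℝ} (h : r ≠ 0) (q : ℝ) :
    reluDir r q = (if 0 < r then 1 else 0) * q := by
  rcases h.lt_or_gt with h | h
  · simp [reluDir_of_neg h, h.le.not_gt]
  · simp [reluDir_of_pos h, h]

theorem reluDir_congr_sign {r r' : ℝ} (h : SignType.sign r = SignType.sign r') (q : ℝ) :
    reluDir r q = reluDir r' q := by
  rcases lt_trichotomy r 0 with h1 | h1 | h1
  · rw [sign_neg h1] at h
    rw [reluDir_of_neg h1, reluDir_of_neg (sign_eq_neg_one_iff.1 h.symm)]
  · rw [h1, sign_zero] at h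
    rw [h1, sign_eq_zero_iff.1 h.symm]
  · rw [sign_pos h1] at h
    rw [reluDir_of_pos h1, reluDir_of_pos (sign_eq_one_iff.1 h.symm)]

theorem reluDir_le_max (r q : ℝ) : reluDir r q ≤ max q 0 := by
  unfold reluDir; split_ifs <;> simp

theorem min_le_reluDir (r q : ℝ) : min q 0 ≤ reluDir r q := by
  unfold reluDir; split_ifs <;> simp

theorem hasDerivWithinAt_relu (r q : ℝ) :
    HasDerivWithinAt (fun t : ℝ => max (r + t * q) 0) (reluDir r q) (Set.Ioi 0) 0 := by
  have hlin : HasDerivAt (fun t : ℝ => r + t * q) q 0 := by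
    simpa using ((hasDerivAt_id (0 : ℝ)).mul_const q).const_add r
  have hcont : ContinuousAt (fun t : ℝ => r + t * q) 0 := hlin.continuousAt
  rcases lt_trichotomy r 0 with h | h | h
  · rw [reluDir_of_neg h]
    refine HasDerivAt.hasDerivWithinAt ((hasDerivAt_const (0 : ℝ) (0 : ℝ)).congr_of_eventuallyEq ?_)
    filter_upwards [hcont.eventually_lt (continuousAt_const (y := (0 : ℝ))) (by simpa using h)]
      with t ht
    exact max_eq_right ht.le
  · subst h
    have h2 : HasDerivWithinAt (fun t : ℝ => t * max q 0) (max q 0) (Set.Ioi 0) 0 := by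
      simpa using ((hasDerivAt_id (0 : ℝ)).mul_const (max q 0)).hasDerivWithinAt
    rw [reluDir_zero_left]
    refine h2.congr (fun t ht => ?_) (by simp)
    have ht' : (0 : ℝ) ≤ t := le_of_lt ht
    rw [mul_max_of_nonneg _ _ ht', zero_add, mul_zero]
  · rw [reluDir_of_pos h]
    refine HasDerivAt.hasDerivWithinAt (hlin.congr_of_eventuallyEq ?_)
    filter_upwards [(continuousAt_const (y := (0 : ℝ))).eventually_lt hcont (by simpa using h)]
      with t ht
    exact max_eq_left ht.le

/-! ### Directional derivatives and Fréchet subgradients of the loss. -/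

section Loss

variable {H d N : ℕ}

theorem hasDerivWithinAt_netOut (z v : Params H d) (a : EuclideanSpace ℝ (Fin d)) :
    HasDerivWithinAt (fun t : ℝ => netOut (z + t • v) a)
      (∑ k, ((v k).fst * max (inner ℝ (z k).snd a) 0 +
        (z k).fst * reluDir (inner ℝ (z k).snd a) (inner ℝ (v k).snd a))) (Set.Ioi 0) 0 := by
  unfold netOut
  refine HasDerivWithinAt.fun_sum fun k _ => ?_
  have h1 : HasDerivWithinAt (fun t : ℝ => (z k).fst + t * (v k).fst) ((v k).fst)
      (Set.Ioi 0) 0 := by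
    simpa using
      (((hasDerivAt_id (0 : ℝ)).mul_const (v k).fst).const_add (z k).fst).hasDerivWithinAt
  have h2 := h1.fun_mul (hasDerivWithinAt_relu (inner ℝ (z k).snd a) (inner ℝ (v k).snd a))
  simpa [inner_add_left, inner_smul_left] using h2

variable (x : Fin N → EuclideanSpace ℝ (Fin d)) (y : Fin N → ℝ)

theorem contDiff_partial_left {ℓ : ℝ → ℝ → ℝ}
    (hℓ : ContDiff ℝ 1 (fun q : ℝ × ℝ => ℓ q.1 q.2)) (b : ℝ) :
    ContDiff ℝ 1 (fun t : ℝ => ℓ t b) :=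
  hℓ.comp (contDiff_id.prodMk contDiff_const)

theorem hasDirDeriv_empLoss {ℓ : ℝ → ℝ → ℝ}
    (hℓ : ContDiff ℝ 1 (fun q : ℝ × ℝ => ℓ q.1 q.2)) (z v : Params H d) :
    HasDirDeriv (empLoss ℓ x y) z v
      (∑ i, rho ℓ x y z i * ∑ k, ((v k).fst * max (inner ℝ (z k).snd (x i)) 0 +
        (z k).fst * reluDir (inner ℝ (z k).snd (x i)) (inner ℝ (v k).snd (x i)))) := by
  have key : HasDerivWithinAt (fun t : ℝ => empLoss ℓ x y (z + t • v))
      (∑ i, rho ℓ x y z i * ∑ k, ((v k).fst * max (inner ℝ (z k).snd (x i)) 0 +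
        (z k).fst * reluDir (inner ℝ (z k).snd (x i)) (inner ℝ (v k).snd (x i))))
      (Set.Ioi 0) 0 := by
    unfold empLoss
    refine HasDerivWithinAt.fun_sum fun i _ => ?_
    have h1 : HasDerivAt (fun t : ℝ => ℓ t (y i)) (rho ℓ x y z i)
        (netOut (z + (0 : ℝ) • v) (x i)) := by
      rw [zero_smul, add_zero]
      exact ((contDiff_partial_left hℓ (y i)).differentiable one_ne_zero _).hasDerivAt
    exact h1.comp_hasDerivWithinAt (0 : ℝ) (hasDerivWithinAt_netOut z v (x i))
  rw [hasDerivWithinAt_iff_tendsto_slope' (by simp)] at key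
  refine key.congr fun t => ?_
  simp [slope_def_field]

theorem hasDirDeriv_unique {E : Type*} [NormedAddCommGroup E] [InnerProductSpace ℝ E]
    {f : E → ℝ} {x v : E} {l l' : ℝ} (h : HasDirDeriv f x v l) (h' : HasDirDeriv f x v l') :
    l = l' := tendsto_nhds_unique h h'

/-- The directional derivative is a sum over neurons of a linear function of the `u`-direction and a
function of the `w`-direction, so the inequality can be tested one neuron at a time. -/
theorem mem_frechetSubdiff_empLoss_iff {ℓ : ℝ → ℝ → ℝ}
    (hℓ : ContDiff ℝ 1 (fun q : ℝ × ℝ => ℓ q.1 q.2)) (z g : Params H d) :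
    g ∈ frechetSubdiff (empLoss ℓ x y) z ↔
      ∀ k, (g k).fst = ∑ i, rho ℓ x y z i * max (inner ℝ (z k).snd (x i)) 0 ∧
        ∀ v, inner ℝ (g k).snd v ≤
          ∑ i, (z k).fst * rho ℓ x y z i *
            reluDir (inner ℝ (z k).snd (x i)) (inner ℝ v (x i)) := by
  have hD : ∀ v : Params H d,
      (∑ i, rho ℓ x y z i * ∑ k, ((v k).fst * max (inner ℝ (z k).snd (x i)) 0 +
        (z k).fst * reluDir (inner ℝ (z k).snd (x i)) (inner ℝ (v k).snd (x i)))) =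
      ∑ k, ((v k).fst * ∑ i, rho ℓ x y z i * max (inner ℝ (z k).snd (x i)) 0 +
        ∑ i, (z k).fst * rho ℓ x y z i *
            reluDir (inner ℝ (z k).snd (x i)) (inner ℝ (v k).snd (x i))) := by
    intro v
    simp_rw [Finset.mul_sum]
    rw [Finset.sum_comm]
    refine Finset.sum_congr rfl fun k _ => ?_
    rw [← Finset.sum_add_distrib]
    exact Finset.sum_congr rfl fun i _ => by ring
  have hmem : g ∈ frechetSubdiff (empLoss ℓ x y) z ↔ ∀ v : Params H d,
      ∑ k, ((g k).fst * (v k).fst + inner ℝ (g k).snd (v k).snd) ≤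
      ∑ k, ((v k).fst * ∑ i, rho ℓ x y z i * max (inner ℝ (z k).snd (x i)) 0 +
        ∑ i, (z k).fst * rho ℓ x y z i *
            reluDir (inner ℝ (z k).snd (x i)) (inner ℝ (v k).snd (x i))) := by
    refine forall_congr' fun v => ?_
    have hin : inner ℝ g v = ∑ k, ((g k).fst * (v k).fst + inner ℝ (g k).snd (v k).snd) := by
      simp [PiLp.inner_apply, WithLp.prod_inner_apply, mul_comm]
    rw [← hin, ← hD v]
    constructor
    · rintro ⟨l, hl, hle⟩
      rwa [← hasDirDeriv_unique hl (hasDirDeriv_empLoss x y hℓ z v)]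
    · intro hle
      exact ⟨_, hasDirDeriv_empLoss x y hℓ z v, hle⟩
  rw [hmem]
  constructor
  · intro h k
    have hs : ∀ (a : ℝ) (b : EuclideanSpace ℝ (Fin d)),
        (g k).fst * a + inner ℝ (g k).snd b ≤
          a * ∑ i, rho ℓ x y z i * max (inner ℝ (z k).snd (x i)) 0 +
          ∑ i, (z k).fst * rho ℓ x y z i *
            reluDir (inner ℝ (z k).snd (x i)) (inner ℝ b (x i)) := by
      intro a b
      have h1 := h (WithLp.toLp 2 (Pi.single k (WithLp.toLp 2 (a, b))))
      rw [Finset.sum_eq_single k (fun j _ hj => by simp [hj]) (by simp),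
        Finset.sum_eq_single k (fun j _ hj => by simp [hj]) (by simp)] at h1
      simpa using h1
    refine ⟨?_, fun v => by simpa using hs 0 v⟩
    -- Linearity in the `u`-direction: the directions `1` and `-1` give the two halves of the
    -- equality.
    have h1 := hs 1 0
    have h2 := hs (-1) 0
    simp only [inner_zero_left, inner_zero_right, reluDir_zero_right, mul_zero,
      Finset.sum_const_zero] at h1 h2
    linarith
  · intro h v
    refine Finset.sum_le_sum fun k _ => ?_
    rw [(h k).1, mul_comm]
    exact add_le_add_right ((h k).2 _) _

theorem continuous_netOut (a : EuclideanSpace ℝ (Fin d)) :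
    Continuous fun p : Params H d => netOut p a := by
  unfold netOut
  refine continuous_finsetSum _ fun k _ => ?_
  have h1 : Continuous fun p : Params H d => p k := by fun_prop
  exact ((WithLp.continuous_fst 2 _ _).comp h1).mul
    ((((WithLp.continuous_snd 2 _ _).comp h1).inner continuous_const).max continuous_const)

theorem continuous_rho {ℓ : ℝ → ℝ → ℝ}
    (hℓ : ContDiff ℝ 1 (fun q : ℝ × ℝ => ℓ q.1 q.2)) (i : Fin N) :
    Continuous fun p : Params H d => rho ℓ x y p i :=
  ((contDiff_partial_left hℓ (y i)).continuous_deriv le_rfl).comp (continuous_netOut (x i))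

end Loss

/-! ### Zonotopes, Gram operators and generic vectors. -/

section LinearAlgebra

variable {E : Type*} [NormedAddCommGroup E] [InnerProductSpace ℝ E] [FiniteDimensional ℝ E]

/-- A vector bounded by the support function of a zonotope belongs to the zonotope. -/
theorem exists_zonotope_coeff {ι : Type*} [Fintype ι] (a : ι → E) (s : E)
    (h : ∀ v, inner ℝ s v ≤ ∑ i, max (inner ℝ (a i) v) 0) :
    ∃ ξ : ι → ℝ, (∀ i, ξ i ∈ Set.Icc (0 : ℝ) 1) ∧ s = ∑ i, ξ i • a i := by
  by_contra hne
  push Not at hne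
  let φ : (ι → ℝ) →ₗ[ℝ] E := Fintype.linearCombination ℝ a
  have hφ : ∀ ξ, φ ξ = ∑ i, ξ i • a i := fun ξ => Fintype.linearCombination_apply ℝ a ξ
  let Z : Set E := φ '' (Set.Icc 0 1)
  have hZc : Convex ℝ Z := (convex_Icc _ _).linear_image φ
  have hZk : IsCompact Z := isCompact_Icc.image (LinearMap.continuous_of_finiteDimensional φ)
  have hs : s ∉ Z := by
    rintro ⟨ξ, hξ, hs⟩
    exact hne ξ (fun i => ⟨hξ.1 i, hξ.2 i⟩) (by rw [← hs, hφ])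
  obtain ⟨f, u, hf, hu⟩ := geometric_hahn_banach_closed_point hZc hZk.isClosed hs
  let v := (InnerProductSpace.toDual ℝ E).symm f
  have hv : ∀ w, inner ℝ w v = f w := fun w => by
    rw [real_inner_comm]; exact InnerProductSpace.toDual_symm_apply
  -- The vertex maximizing the separating functional; its value is the support function, which
  -- contradicts strict separation.
  let ξ : ι → ℝ := fun i => if 0 < f (a i) then 1 else 0
  have hξ : ξ ∈ Set.Icc (0 : ι → ℝ) 1 := by
    constructor <;> intro i <;> simp only [ξ] <;> split_ifs <;> simp
  have h1 := hf _ ⟨ξ, hξ, rfl⟩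
  have h2 := h v
  rw [hv] at h2
  have h3 : f (φ ξ) = ∑ i, max (inner ℝ (a i) v) 0 := by
    rw [hφ, map_sum]
    refine Finset.sum_congr rfl fun i _ => ?_
    rw [hv, map_smul]
    simp only [ξ]
    split_ifs with hi
    · simp [hi.le]
    · simp [not_lt.1 hi]
  linarith

/-- A symmetric operator compressed to a nonzero subspace has an eigenvector. -/
theorem exists_compressed_eigenvector (U : Submodule ℝ E) (hU : U ≠ ⊥) (R : E →ₗ[ℝ] E)
    (hR : R.IsSymmetric) :
    ∃ d ∈ U, d ≠ 0 ∧ ∃ μ : ℝ, ∀ e ∈ U, inner ℝ (R d) e = μ * inner ℝ d e := by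
  let C : U →ₗ[ℝ] U := (U.orthogonalProjectionOnto : E →ₗ[ℝ] U) ∘ₗ R ∘ₗ U.subtype
  have hCi : ∀ d e : U, inner ℝ (C d) e = inner ℝ (R d) (e : E) := fun d e => by
    simp [C]
  have hC : C.IsSymmetric := fun d e => by
    rw [hCi, hR, real_inner_comm (C e), hCi, real_inner_comm]
  have : Nontrivial U := Submodule.nontrivial_iff_ne_bot.2 hU
  obtain ⟨d, hd⟩ := hC.hasEigenvalue_iSup_of_finiteDimensional.exists_hasEigenvector
  refine ⟨d, d.2, by simpa using hd.2,
    ⨆ x : {x : U // x ≠ 0}, RCLike.re (inner ℝ (C x) x) / ‖(x : U)‖ ^ 2, fun e he => ?_⟩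
  have := hCi d ⟨e, he⟩
  rw [hd.apply_eq_smul] at this
  rw [← this, real_inner_smul_left]
  rfl

/-- If the spans of two finite families meet nontrivially, then the Gram-type operators of the
two families agree, up to a positive factor, at some vector that the second one does not kill. -/
theorem exists_sum_inner_smul_eq {ι κ : Type*} [Fintype ι] [Fintype κ] (a : ι → E) (b : κ → E)
    (h : Submodule.span ℝ (Set.range a) ⊓ Submodule.span ℝ (Set.range b) ≠ ⊥) :
    ∃ (v : E) (c : ℝ), 0 < c ∧
      ∑ i, inner ℝ v (a i) • a i = c • ∑ j, inner ℝ v (b j) • b j ∧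
      ∃ j, inner ℝ v (b j) ≠ 0 := by
  classical
  let T₁ : EuclideanSpace ℝ (ι ⊕ κ) →ₗ[ℝ] E :=
    ∑ i, (LinearMap.toSpanSingleton ℝ E (a i)) ∘ₗ (EuclideanSpace.projₗ (Sum.inl i))
  let T₂ : EuclideanSpace ℝ (ι ⊕ κ) →ₗ[ℝ] E :=
    ∑ j, (LinearMap.toSpanSingleton ℝ E (b j)) ∘ₗ (EuclideanSpace.projₗ (Sum.inr j))
  have hT₁ : ∀ d, T₁ d = ∑ i, d (Sum.inl i) • a i := fun d => by simp [T₁, EuclideanSpace.projₗ]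
  have hT₂ : ∀ d, T₂ d = ∑ j, d (Sum.inr j) • b j := fun d => by simp [T₂, EuclideanSpace.projₗ]
  -- `D` consists of the pairs of coefficient vectors with equal sums; `K` of those where both sums
  -- vanish. The eigenvector is sought in `D` modulo `K`, so that its common sum is nonzero.
  let D := LinearMap.ker (T₁ - T₂)
  let K := LinearMap.ker T₁ ⊓ LinearMap.ker T₂
  have hD : ∀ d, d ∈ D ↔ T₁ d = T₂ d := fun d => by simp [D, sub_eq_zero]
  have hKD : K ≤ D := fun d hd => by
    rw [hD, LinearMap.mem_ker.1 hd.1, LinearMap.mem_ker.1 hd.2]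
  have hU : Kᗮ ⊓ D ≠ ⊥ := by
    intro hbot
    have hsup := Submodule.sup_orthogonal_inf_of_hasOrthogonalProjection hKD
    rw [hbot, sup_bot_eq] at hsup
    obtain ⟨z, hz, hz0⟩ := Submodule.exists_mem_ne_zero_of_ne_bot h
    obtain ⟨α, hα⟩ := (Submodule.mem_span_range_iff_exists_fun ℝ).1 hz.1
    obtain ⟨β, hβ⟩ := (Submodule.mem_span_range_iff_exists_fun ℝ).1 hz.2
    let d : EuclideanSpace ℝ (ι ⊕ κ) := WithLp.toLp 2 (Sum.elim α β)
    have h1 : T₁ d = z := by rw [hT₁, ← hα]; rfl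
    have h2 : T₂ d = z := by rw [hT₂, ← hβ]; rfl
    have hdK : d ∈ K := by rw [hsup, hD, h1, h2]
    exact hz0 (h1 ▸ LinearMap.mem_ker.1 hdK.1)
  -- The orthogonal projection onto the `ι`-coordinates.
  let R : EuclideanSpace ℝ (ι ⊕ κ) →ₗ[ℝ] EuclideanSpace ℝ (ι ⊕ κ) := ∑ i : ι, (LinearMap.toSpanSingleton ℝ (EuclideanSpace ℝ (ι ⊕ κ))
    (EuclideanSpace.single (Sum.inl i) 1)) ∘ₗ (EuclideanSpace.projₗ (Sum.inl i))
  have hRi : ∀ d e, inner ℝ (R d) e = ∑ i, d (Sum.inl i) * e (Sum.inl i) := fun d e => by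
    simp [R, EuclideanSpace.projₗ, sum_inner, real_inner_smul_left, EuclideanSpace.inner_single_left]
  have hin : ∀ d e : EuclideanSpace ℝ (ι ⊕ κ), inner ℝ d e = ∑ i, d (Sum.inl i) * e (Sum.inl i) +
      ∑ j, d (Sum.inr j) * e (Sum.inr j) := fun d e => by
    simp [PiLp.inner_apply, Fintype.sum_sum_type, mul_comm]
  have hR : R.IsSymmetric := fun d e => by
    rw [hRi, real_inner_comm, hRi]; simp [mul_comm]
  obtain ⟨d, hdU, hd0, μ, hμ⟩ := exists_compressed_eigenvector _ hU R hR
  have hdD : T₁ d = T₂ d := (hD d).1 hdU.2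
  have hnotK : T₁ d ≠ 0 := fun h0 => by
    have hdK : d ∈ K := ⟨h0, hdD.symm.trans h0⟩
    exact hd0 (inner_self_eq_zero (𝕜 := ℝ).1 (hdU.1 d hdK))
  have hα0 : ∃ i, d (Sum.inl i) ≠ 0 := by
    by_contra! hc
    exact hnotK (by simp [hT₁, hc])
  have hβ0 : ∃ j, d (Sum.inr j) ≠ 0 := by
    by_contra! hc
    exact hnotK (by simp [hdD, hT₂, hc])
  have hαs : 0 < ∑ i, d (Sum.inl i) * d (Sum.inl i) := by
    obtain ⟨i, hi⟩ := hα0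
    exact Finset.sum_pos' (fun i _ => mul_self_nonneg _)
      ⟨i, Finset.mem_univ _, mul_self_pos.2 hi⟩
  have hβs : 0 < ∑ j, d (Sum.inr j) * d (Sum.inr j) := by
    obtain ⟨i, hi⟩ := hβ0
    exact Finset.sum_pos' (fun i _ => mul_self_nonneg _)
      ⟨i, Finset.mem_univ _, mul_self_pos.2 hi⟩
  have hμd := hμ d hdU
  rw [hRi, hin] at hμd
  -- Both blocks of `d` are nonzero and `‖α‖² = μ (‖α‖² + ‖β‖²)`, which puts `μ` strictly between
  -- `0` and `1`.
  have hμ0 : 0 < μ := by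
    by_contra hc
    nlinarith
  have hμ1 : 0 < 1 - μ := by
    by_contra hc
    nlinarith
  -- `R` maps `K` into itself and `d` is orthogonal to `K`, so both sides vanish on `K` and the
  -- eigenvector relation extends to all of `D`.
  have horth : ∀ e ∈ D, inner ℝ (R d) e = μ * inner ℝ d e := by
    intro e he
    rw [← Submodule.sup_orthogonal_inf_of_hasOrthogonalProjection hKD] at he
    obtain ⟨e₁, he₁, e₂, he₂, rfl⟩ := Submodule.mem_sup.1 he
    have h1 : inner ℝ d e₁ = 0 := by rw [real_inner_comm]; exact hdU.1 e₁ he₁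
    have h2 : inner ℝ (R d) e₁ = 0 := by
      obtain ⟨e₃, he₃⟩ : ∃ e₃, e₃ = R e₁ := ⟨_, rfl⟩
      have h3 : ∀ i, e₃ (Sum.inl i) = e₁ (Sum.inl i) := fun i => by
        have := hRi e₁ (EuclideanSpace.single (Sum.inl i) 1)
        rw [← he₃] at this
        simpa [EuclideanSpace.inner_single_right, Pi.single_apply] using this
      have h4 : ∀ j, e₃ (Sum.inr j) = 0 := fun j => by
        have := hRi e₁ (EuclideanSpace.single (Sum.inr j) 1)
        rw [← he₃] at this
        simpa [EuclideanSpace.inner_single_right, Pi.single_apply] using this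
      have h5 : e₃ ∈ K := by
        constructor
        · have : T₁ e₃ = T₁ e₁ := by simp [hT₁, h3]
          exact this.trans (LinearMap.mem_ker.1 he₁.1)
        · show T₂ e₃ = 0
          simp [hT₂, h4]
      rw [hR, ← he₃, real_inner_comm]
      exact hdU.1 e₃ h5
    rw [inner_add_right, inner_add_right, h1, h2, zero_add, zero_add]
    exact hμ e₂ he₂
  have hmem : R d - μ • d ∈ Dᗮ := fun e he => by
    rw [real_inner_comm, inner_sub_left, real_inner_smul_left, horth e he, sub_self]
  -- The residual is thus the adjoint of `T₁ - T₂` at some `v`; its coordinates are `inner ℝ v (a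
  -- i)` and `-inner ℝ v (b j)`.
  have hrange : Dᗮ = LinearMap.range (LinearMap.adjoint (T₁ - T₂)) := by
    rw [← LinearMap.orthogonal_ker]
  rw [hrange] at hmem
  obtain ⟨v, hv⟩ := hmem
  have hve : ∀ e, inner ℝ v (T₁ e) - inner ℝ v (T₂ e) = inner ℝ (R d) e - μ * inner ℝ d e := by
    intro e
    rw [← real_inner_smul_left, ← inner_sub_left, ← hv, LinearMap.adjoint_inner_left,
      LinearMap.sub_apply, inner_sub_right]
  have hva : ∀ i, inner ℝ v (a i) = (1 - μ) * d (Sum.inl i) := fun i => by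
    have := hve (EuclideanSpace.single (Sum.inl i) 1)
    simp [hT₁, hT₂, hRi, hin] at this
    linarith
  have hvb : ∀ j, inner ℝ v (b j) = μ * d (Sum.inr j) := fun j => by
    have := hve (EuclideanSpace.single (Sum.inr j) 1)
    simp [hT₁, hT₂, hRi, hin] at this
    linarith
  refine ⟨v, (1 - μ) / μ, by positivity, ?_, ?_⟩
  · simp_rw [hva, hvb, mul_smul, ← Finset.smul_sum, ← hT₁, ← hT₂, hdD, smul_smul]
    congr 1
    field_simp
  · obtain ⟨j, hj⟩ := hβ0
    exact ⟨j, by rw [hvb]; exact mul_ne_zero hμ0.ne' hj⟩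

/-- A proper subspace has empty interior, and a finite intersection of dense open sets is dense. -/
theorem dense_forall_apply_ne_zero {F : Type*} [NormedAddCommGroup F] [NormedSpace ℝ F]
    {ι : Type*} [Finite ι] (f : ι → F →L[ℝ] ℝ) (hf : ∀ i, f i ≠ 0) :
    Dense {v : F | ∀ i, f i v ≠ 0} := by
  have hopen : ∀ i, IsOpen {v : F | f i v ≠ 0} := fun i =>
    isOpen_ne_fun (f i).continuous continuous_const
  have hdense : ∀ i, Dense {v : F | f i v ≠ 0} := fun i => by
    rw [← compl_compl {v : F | f i v ≠ 0}, ← interior_eq_empty_iff_dense_compl]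
    by_contra hne
    have htop := Submodule.eq_top_of_nonempty_interior' (LinearMap.ker (f i : F →ₗ[ℝ] ℝ)) (by
      convert Set.nonempty_iff_ne_empty.2 hne using 2
      ext v; simp)
    refine hf i (ContinuousLinearMap.ext fun v => ?_)
    have : v ∈ LinearMap.ker (f i : F →ₗ[ℝ] ℝ) := htop ▸ Submodule.mem_top
    simpa using this
  have : {v : F | ∀ i, f i v ≠ 0} = ⋂ i, {v : F | f i v ≠ 0} := by ext; simp
  rw [this]
  cases nonempty_fintype ι
  classical
  have hfin : ∀ s : Finset ι, Dense (⋂ i ∈ s, {v : F | f i v ≠ 0}) ∧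
      IsOpen (⋂ i ∈ s, {v : F | f i v ≠ 0}) := by
    intro s
    induction s using Finset.induction_on with
    | empty => simp
    | insert i s _ ih =>
      rw [Finset.set_biInter_insert]
      exact ⟨(hdense i).inter_of_isOpen_left ih.1 (hopen i), (hopen i).inter ih.2⟩
  simpa using (hfin Finset.univ).1

theorem orthogonal_sup_orthogonal_eq_top {V W : Submodule ℝ E} (h : V ⊓ W = ⊥) :
    Vᗮ ⊔ Wᗮ = ⊤ := by
  rw [← Submodule.orthogonal_eq_bot_iff, ← Submodule.inf_orthogonal,
    Submodule.orthogonal_orthogonal, Submodule.orthogonal_orthogonal, h]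

end LinearAlgebra

/-! ### Generic perturbations and stability of ramp subgradients. -/

section InnerProduct

variable {E : Type*} [NormedAddCommGroup E] [InnerProductSpace ℝ E]

/-- A vector of a subspace can be perturbed inside it so that it is orthogonal to no member of a
finite family outside the orthogonal complement, keeping the nonzero signs. -/
theorem exists_generic_perturbation {ι : Type*} [Finite ι] (x : ι → E) (W : Submodule ℝ E)
    {v₀ : E} (hv₀ : v₀ ∈ W) :
    ∃ v ∈ W, (∀ i, x i ∉ Wᗮ → inner ℝ (x i) v ≠ 0) ∧
      ∀ i, inner ℝ (x i) v₀ ≠ 0 → 0 < inner ℝ (x i) v₀ * inner ℝ (x i) v := by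
  let f : {i // x i ∉ Wᗮ} → W →L[ℝ] ℝ := fun i => (innerSL ℝ (x i)).comp W.subtypeL
  have hf : ∀ i, f i ≠ 0 := by
    rintro ⟨i, hi⟩ h0
    refine hi fun w hw => ?_
    rw [real_inner_comm]
    simpa [f] using congrArg (fun g => g ⟨w, hw⟩) h0
  let O : Set W := ⋂ i : {i // inner ℝ (x i) v₀ ≠ 0},
    {v : W | 0 < inner ℝ (x i) v₀ * inner ℝ (x i) (v : E)}
  have hO : IsOpen O := isOpen_iInter_of_finite fun i =>
    isOpen_lt continuous_const (by fun_prop)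
  obtain ⟨v, hvO, hv⟩ := (dense_forall_apply_ne_zero f hf).inter_open_nonempty O hO
    ⟨⟨v₀, hv₀⟩, Set.mem_iInter.2 fun i => mul_self_pos.2 i.2⟩
  exact ⟨v, v.2, fun i hi => by simpa [f] using hv ⟨i, hi⟩,
    fun i hi => Set.mem_iInter.1 hvO ⟨i, hi⟩⟩

/-- Subgradients of a nonnegative combination of ramps persist under small perturbations of the
weights, provided that every vector lies in the span of those with positive weight. -/
theorem exists_tendsto_subgradient {ι α : Type*} {l : Filter α} (T : Finset ι) (x : ι → E)
    (b : α → ι → ℝ) (b₀ ξ : ι → ℝ) (hb : ∀ i ∈ T, Tendsto (fun t => b t i) l (𝓝 (b₀ i)))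
    (P : Finset ι) (hPT : P ⊆ T) (hξ : ∀ i ∈ P, ξ i ∈ Set.Icc (0 : ℝ) 1)
    (hPpos : ∀ i ∈ P, 0 < b₀ i) (hTP : ∀ i ∈ T, i ∉ P → b₀ i = 0)
    (hspan : ∀ i ∈ T, x i ∈ Submodule.span ℝ (x '' (P : Set ι))) :
    ∃ s : α → E, Tendsto s l (𝓝 (∑ i ∈ T, (b₀ i * ξ i) • x i)) ∧
      ∀ᶠ t in l, ∀ v, inner ℝ (s t) v ≤ ∑ i ∈ T, b t i * max (inner ℝ v (x i)) 0 := by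
  have hc : ∀ i ∈ T, ∃ c : ι → ℝ, ∑ j ∈ P, c j • x j = x i := fun i hi =>
    by
    obtain ⟨c, hc⟩ := (Submodule.mem_span_image_finset_iff_exists_fun ℝ).1 (hspan i hi)
    classical
    refine ⟨fun j => if h : j ∈ P then c ⟨j, h⟩ else 0, ?_⟩
    rw [← hc, ← Finset.sum_coe_sort P]
    simp
  choose! c hc using hc
  -- With `max q 0 = (q + |q|) / 2`, only the absolute values need care. Each `|q i|` is at most `∑
  -- |c i j| |q j|` over `P`, so `κ` is what is left of the positive weights after paying for all
  -- weight errors.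
  let κ : α → ι → ℝ := fun t j => b₀ j / 2 - ∑ i ∈ T, |b t i - b₀ i| / 2 * |c i j|
  have hκ : ∀ j, Tendsto (fun t => κ t j) l (𝓝 (b₀ j / 2)) := by
    intro j
    have h1 : Tendsto (fun t => ∑ i ∈ T, |b t i - b₀ i| / 2 * |c i j|) l
        (𝓝 (∑ i ∈ T, |b₀ i - b₀ i| / 2 * |c i j|)) :=
      tendsto_finsetSum _ fun i hi =>
        ((((hb i hi).sub_const _).abs).div_const _).mul_const _
    simpa using h1.const_sub (b₀ j / 2)
  have hsum0 : ∀ g : ι → E, ∑ i ∈ T, b₀ i • g i = ∑ i ∈ P, b₀ i • g i := fun g =>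
    (Finset.sum_subset hPT fun i hi hiP => by simp [hTP i hi hiP]).symm
  have hsum0' : ∀ g : ι → ℝ, ∑ i ∈ T, b₀ i * g i = ∑ i ∈ P, b₀ i * g i := fun g =>
    (Finset.sum_subset hPT fun i hi hiP => by simp [hTP i hi hiP]).symm
  refine ⟨fun t => ∑ i ∈ T, (b t i / 2) • x i + ∑ j ∈ P, (κ t j * (2 * ξ j - 1)) • x j, ?_, ?_⟩
  · have hlim : ∑ i ∈ T, (b₀ i * ξ i) • x i =
        ∑ i ∈ T, (b₀ i / 2) • x i + ∑ j ∈ P, (b₀ j / 2 * (2 * ξ j - 1)) • x j := by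
      have e1 : ∑ i ∈ T, (b₀ i * ξ i) • x i = ∑ i ∈ P, (b₀ i * ξ i) • x i := by
        simpa [mul_smul] using hsum0 fun i => ξ i • x i
      have e2 : ∑ i ∈ T, (b₀ i / 2) • x i = ∑ i ∈ P, (b₀ i / 2) • x i := by
        simpa [div_eq_mul_inv, mul_smul] using hsum0 fun i => (2 : ℝ)⁻¹ • x i
      rw [e1, e2, ← Finset.sum_add_distrib]
      refine Finset.sum_congr rfl fun i _ => ?_
      rw [← add_smul]
      congr 1
      ring
    rw [hlim]
    refine Tendsto.add (tendsto_finsetSum _ fun i hi => ?_) (tendsto_finsetSum _ fun j _ => ?_)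
    · exact ((hb i hi).div_const _).smul_const _
    · exact ((hκ j).mul_const _).smul_const _
  · have hev : ∀ᶠ t in l, ∀ j ∈ P, 0 < κ t j := by
      rw [Finset.eventually_all]
      exact fun j hj => (hκ j).eventually_const_lt (half_pos (hPpos j hj))
    filter_upwards [hev] with t ht v
    let q : ι → ℝ := fun i => inner ℝ v (x i)
    have hq : ∀ i ∈ T, |q i| ≤ ∑ j ∈ P, |c i j| * |q j| := by
      intro i hi
      have : q i = ∑ j ∈ P, c i j * q j := by
        simp only [q]
        conv_lhs => rw [← hc i hi]
        simp [inner_sum, inner_smul_right]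
      rw [this]
      refine (Finset.abs_sum_le_sum_abs _ _).trans (le_of_eq ?_)
      simp [abs_mul]
    have hmax : ∀ i, max (q i) 0 = (q i + |q i|) / 2 := fun i => by
      rw [max_def]; split_ifs with h0
      · rw [abs_of_nonpos h0]; ring
      · rw [abs_of_pos (not_le.1 h0)]; ring
    have hleft : inner ℝ (∑ i ∈ T, (b t i / 2) • x i +
        ∑ j ∈ P, (κ t j * (2 * ξ j - 1)) • x j) v =
        ∑ i ∈ T, b t i / 2 * q i + ∑ j ∈ P, κ t j * (2 * ξ j - 1) * q j := by
      rw [real_inner_comm]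
      simp [q, inner_add_right, inner_sum, real_inner_smul_right]
    have hright : ∑ i ∈ T, b t i * max (q i) 0 =
        ∑ i ∈ T, b t i / 2 * q i + ∑ i ∈ T, b t i / 2 * |q i| := by
      rw [← Finset.sum_add_distrib]
      exact Finset.sum_congr rfl fun i _ => by rw [hmax]; ring
    have h1 : ∑ j ∈ P, κ t j * (2 * ξ j - 1) * q j ≤ ∑ j ∈ P, κ t j * |q j| := by
      refine Finset.sum_le_sum fun j hj => ?_
      rw [mul_assoc]
      refine mul_le_mul_of_nonneg_left ?_ (ht j hj).le
      refine (le_abs_self _).trans ?_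
      rw [abs_mul]
      refine mul_le_of_le_one_left (abs_nonneg _) (abs_le.2 ?_)
      constructor <;> linarith [(hξ j hj).1, (hξ j hj).2]
    have h2 : ∑ j ∈ P, κ t j * |q j| = ∑ i ∈ T, b₀ i / 2 * |q i| -
        ∑ i ∈ T, |b t i - b₀ i| / 2 * ∑ j ∈ P, |c i j| * |q j| := by
      have e1 : ∑ i ∈ T, b₀ i / 2 * |q i| = ∑ i ∈ P, b₀ i / 2 * |q i| := by
        simpa [div_eq_mul_inv, mul_assoc] using hsum0' fun i => (2 : ℝ)⁻¹ * |q i|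
      rw [e1]
      simp_rw [κ, sub_mul, Finset.sum_sub_distrib, Finset.sum_mul, Finset.mul_sum]
      rw [Finset.sum_comm (s := P)]
      simp [mul_assoc]
    have h3 : ∑ i ∈ T, |b t i - b₀ i| / 2 * |q i| ≤
        ∑ i ∈ T, |b t i - b₀ i| / 2 * ∑ j ∈ P, |c i j| * |q j| :=
      Finset.sum_le_sum fun i hi => mul_le_mul_of_nonneg_left (hq i hi) (by positivity)
    have h4 : ∑ i ∈ T, b₀ i / 2 * |q i| - ∑ i ∈ T, |b t i - b₀ i| / 2 * |q i| ≤
        ∑ i ∈ T, b t i / 2 * |q i| := by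
      rw [← Finset.sum_sub_distrib]
      refine Finset.sum_le_sum fun i _ => ?_
      rw [← sub_mul]
      refine mul_le_mul_of_nonneg_right ?_ (abs_nonneg _)
      linarith [neg_abs_le (b t i - b₀ i)]
    change _ ≤ ∑ i ∈ T, b t i * max (q i) 0
    rw [hleft, hright]
    linarith

end InnerProduct

theorem mem_limitingSubdiff_of_tendsto {E α : Type*} [NormedAddCommGroup E]
    [InnerProductSpace ℝ E] {l : Filter α} [l.NeBot] [l.IsCountablyGenerated] {f : E → ℝ}
    {p s : E} (z g : α → E) (hz : Tendsto z l (𝓝 p)) (hg : Tendsto g l (𝓝 s))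
    (h : ∀ᶠ t in l, g t ∈ frechetSubdiff f (z t)) : s ∈ limitingSubdiff f p := by
  obtain ⟨u, hu⟩ := exists_seq_tendsto l
  obtain ⟨n, hn⟩ := eventually_atTop.1 (hu.eventually h)
  have hu' : Tendsto (fun m => u (m + n)) atTop l := (tendsto_add_atTop_iff_nat n).2 hu
  exact ⟨fun m => z (u (m + n)), fun m => g (u (m + n)), hz.comp hu', hg.comp hu',
    fun m => hn _ (Nat.le_add_left n m)⟩

theorem exists_frequently_eq {α β : Type*} [Finite β] {l : Filter α} [l.NeBot] (f : α → β) :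
    ∃ b, ∃ᶠ t in l, f t = b := by
  by_contra! h
  obtain ⟨t, ht⟩ := (eventually_all.2 h).exists
  exact ht _ rfl

/-! ### The two inclusions and the necessity of the span condition. -/

section ChainRule

variable {H d N : ℕ} {ℓ : ℝ → ℝ → ℝ} {x : Fin N → EuclideanSpace ℝ (Fin d)} {y : Fin N → ℝ}
  {p : Params H d}

theorem mem_idxPlus {k : Fin H} {i : Fin N} : i ∈ idxPlus ℓ x y p k ↔
    inner ℝ (p k).snd (x i) = 0 ∧ 0 ≤ (p k).fst * rho ℓ x y p i := by simp [idxPlus]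

theorem mem_idxPos {k : Fin H} {i : Fin N} : i ∈ idxPos ℓ x y p k ↔
    inner ℝ (p k).snd (x i) = 0 ∧ 0 < (p k).fst * rho ℓ x y p i := by simp [idxPos]

theorem mem_idxMinus {k : Fin H} {i : Fin N} : i ∈ idxMinus ℓ x y p k ↔
    inner ℝ (p k).snd (x i) = 0 ∧ (p k).fst * rho ℓ x y p i < 0 := by simp [idxMinus]

/-- Membership in `G_k^L` through one multiplier for each data point. -/
theorem mem_limitingG_iff {k : Fin H} {g : EuclideanSpace ℝ (Fin d)} :
    g ∈ limitingG ℓ x y p k ↔ ∃ (c : Fin N → ℝ) (v : EuclideanSpace ℝ (Fin d)),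
      (∀ i, inner ℝ (p k).snd (x i) ≠ 0 →
        c i = if 0 < inner ℝ (p k).snd (x i) then 1 else 0) ∧
      (∀ i ∈ idxPlus ℓ x y p k, c i ∈ Set.Icc (0 : ℝ) 1) ∧
      (∀ i ∈ idxMinus ℓ x y p k, inner ℝ v (x i) ≠ 0 ∧
        c i = if 0 < inner ℝ v (x i) then 1 else 0) ∧
      g = ∑ i, ((p k).fst * rho ℓ x y p i * c i) • x i := by
  have hdisj : Disjoint (idxPlus ℓ x y p k) (idxMinus ℓ x y p k) := by
    rw [Finset.disjoint_left]
    intro i hi hi'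
    exact (mem_idxPlus.1 hi).2.not_gt (mem_idxMinus.1 hi').2
  have hcompl : ∀ i, i ∈ (idxPlus ℓ x y p k ∪ idxMinus ℓ x y p k)ᶜ ↔
      inner ℝ (p k).snd (x i) ≠ 0 := by
    intro i
    rw [Finset.mem_compl, Finset.mem_union, mem_idxPlus, mem_idxMinus, ← and_or_left, not_and_or,
      or_iff_left (not_not.2 (le_or_gt _ _))]
  have hsplit : ∀ f : Fin N → EuclideanSpace ℝ (Fin d), ∑ i, f i =
      ∑ i ∈ (idxPlus ℓ x y p k ∪ idxMinus ℓ x y p k)ᶜ, f i +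
      ∑ i ∈ idxPlus ℓ x y p k, f i + ∑ i ∈ idxMinus ℓ x y p k, f i := by
    intro f
    rw [add_assoc, ← Finset.sum_union hdisj, Finset.sum_compl_add_sum]
  constructor
  · rintro ⟨ξ, v, hξ, hv, rfl⟩
    refine ⟨fun i => if i ∈ idxPlus ℓ x y p k then ξ i else if i ∈ idxMinus ℓ x y p k then
      (if 0 < inner ℝ v (x i) then 1 else 0) else
      (if 0 < inner ℝ (p k).snd (x i) then 1 else 0), v, ?_, ?_, ?_, ?_⟩
    · intro i hi
      have h1 : i ∉ idxPlus ℓ x y p k := fun h => hi (mem_idxPlus.1 h).1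
      have h2 : i ∉ idxMinus ℓ x y p k := fun h => hi (mem_idxMinus.1 h).1
      simp [h1, h2]
    · intro i hi
      simpa [hi] using hξ i
    · intro i hi
      have h1 : i ∉ idxPlus ℓ x y p k := fun h => Finset.disjoint_left.1 hdisj h hi
      refine ⟨?_, by simp [h1, hi]⟩
      rw [real_inner_comm]
      exact abs_pos.1 (hv i hi)
    · rw [hsplit]
      congr 1
      · congr 1
        · refine Finset.sum_congr rfl fun i hi => ?_
          have hi' := (hcompl i).1 hi
          have h1 : i ∉ idxPlus ℓ x y p k := fun h => hi' (mem_idxPlus.1 h).1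
          have h2 : i ∉ idxMinus ℓ x y p k := fun h => hi' (mem_idxMinus.1 h).1
          simp [h1, h2]
        · exact Finset.sum_congr rfl fun i hi => by simp [hi]
      · refine Finset.sum_congr rfl fun i hi => ?_
        have h1 : i ∉ idxPlus ℓ x y p k := fun h => Finset.disjoint_left.1 hdisj h hi
        simp [h1, hi]
  · rintro ⟨c, v, hoff, hplus, hminus, rfl⟩
    refine ⟨fun i => if i ∈ idxPlus ℓ x y p k then c i else 0, v, ?_, ?_, ?_⟩
    · intro i
      dsimp only
      split_ifs with hi
      · exact hplus i hi
      · simp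
    · intro i hi
      rw [real_inner_comm]
      exact abs_pos.2 (hminus i hi).1
    · rw [hsplit]
      congr 1
      · congr 1
        · exact Finset.sum_congr rfl fun i hi => by rw [hoff i ((hcompl i).1 hi)]
        · exact Finset.sum_congr rfl fun i hi => by simp [hi]
      · exact Finset.sum_congr rfl fun i hi => by rw [(hminus i hi).2]

/-- Limiting subgradients of the empirical loss are controlled by the activation pattern of some
nearby weight. -/
theorem exists_weight_of_mem_limitingSubdiff
    (hℓ : ContDiff ℝ 1 (fun q : ℝ × ℝ => ℓ q.1 q.2)) {s : Params H d}
    (hs : s ∈ limitingSubdiff (empLoss ℓ x y) p) (k : Fin H) :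
    (s k).fst = ∑ i, rho ℓ x y p i * max (inner ℝ (p k).snd (x i)) 0 ∧
    ∃ w : EuclideanSpace ℝ (Fin d),
      (∀ i, inner ℝ (p k).snd (x i) ≠ 0 → 0 < inner ℝ (p k).snd (x i) * inner ℝ w (x i)) ∧
      ∀ v, inner ℝ (s k).snd v ≤ ∑ i, (p k).fst * rho ℓ x y p i *
        reluDir (inner ℝ w (x i)) (inner ℝ v (x i)) := by
  obtain ⟨z, g, hz, hg, hzg⟩ := hs
  simp_rw [mem_frechetSubdiff_empLoss_iff x y hℓ] at hzg
  have hk : Continuous fun q : Params H d => q k := by fun_prop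
  have hfst : Continuous fun q : Params H d => (q k).fst := (WithLp.continuous_fst 2 _ _).comp hk
  have hsnd : Continuous fun q : Params H d => (q k).snd := (WithLp.continuous_snd 2 _ _).comp hk
  have hin : ∀ i, Continuous fun q : Params H d => inner ℝ (q k).snd (x i) := fun i =>
    hsnd.inner continuous_const
  have hrho := fun i => continuous_rho (H := H) x y hℓ i
  constructor
  · refine tendsto_nhds_unique ((hfst.tendsto s).comp hg) ?_
    have hc : Continuous fun q : Params H d =>
        ∑ i, rho ℓ x y q i * max (inner ℝ (q k).snd (x i)) 0 :=
      continuous_finsetSum _ fun i _ => (hrho i).mul ((hin i).max continuous_const)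
    exact ((hc.tendsto p).comp hz).congr fun n => ((hzg n k).1).symm
  -- Pigeonhole over sign patterns: one pattern recurs infinitely often, and a fixed pattern makes
  -- the right-hand side continuous in the weights.
  · obtain ⟨σ, hσ⟩ := exists_frequently_eq (l := atTop)
      fun n i => SignType.sign (inner ℝ (z n k).snd (x i))
    have hev : ∀ᶠ n in atTop, ∀ i, inner ℝ (p k).snd (x i) ≠ 0 →
        0 < inner ℝ (p k).snd (x i) * inner ℝ (z n k).snd (x i) := by
      rw [eventually_all]
      intro i
      rw [eventually_imp_distrib_left]
      intro hi
      exact ((((hin i).tendsto p).comp hz).const_mul _).eventually_const_lt (mul_self_pos.2 hi)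
    obtain ⟨m, hm, hm'⟩ := (hσ.and_eventually hev).exists
    refine ⟨(z m k).snd, hm', fun v => ?_⟩
    have hlim : Tendsto (fun n => inner ℝ (g n k).snd v - ∑ i, (z n k).fst * rho ℓ x y (z n) i *
        reluDir (inner ℝ (z m k).snd (x i)) (inner ℝ v (x i))) atTop
        (𝓝 (inner ℝ (s k).snd v - ∑ i, (p k).fst * rho ℓ x y p i *
        reluDir (inner ℝ (z m k).snd (x i)) (inner ℝ v (x i)))) := by
      refine Tendsto.sub (((hsnd.inner continuous_const).tendsto s).comp hg)
        (tendsto_finsetSum _ fun i _ => ?_)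
      exact (((hfst.mul (hrho i)).tendsto p).comp hz).mul_const _
    refine sub_nonpos.1 (le_of_tendsto_of_frequently hlim (hσ.mono fun n hn => ?_))
    refine sub_nonpos.2 (((hzg n k).2 v).trans (le_of_eq (Finset.sum_congr rfl fun i _ => ?_)))
    rw [reluDir_congr_sign (congrFun (hn.trans hm.symm) i)]

/-- Adding the inequalities for `v` and `-v` leaves only the terms on a kink. -/
theorem reluDir_add_reluDir_neg (r q : ℝ) :
    reluDir r q + reluDir r (-q) = if r = 0 then |q| else 0 := by
  rcases lt_trichotomy r 0 with h | h | h
  · simp [reluDir_of_neg h, h.ne]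
  · subst h
    simp only [reluDir_zero_left, if_true]
    rcases le_total q 0 with hq | hq
    · simp [abs_of_nonpos hq, hq]
    · simp [abs_of_nonneg hq, hq]
  · simp [reluDir_of_pos h, h.ne']

theorem limitingSubdiff_subset_chainSet (hℓ : ContDiff ℝ 1 (fun q : ℝ × ℝ => ℓ q.1 q.2))
    (hx : ∀ i, x i ≠ 0) (hq : ActiveSpanQual ℓ x y p) :
    limitingSubdiff (empLoss ℓ x y) p ⊆ chainSet ℓ x y p := by
  classical
  intro s hs k
  obtain ⟨hfst, w, hw, hle⟩ := exists_weight_of_mem_limitingSubdiff hℓ hs k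
  refine ⟨hfst, ?_⟩
  have hw0 : ∀ i, inner ℝ w (x i) = 0 → inner ℝ (p k).snd (x i) = 0 := fun i hi => by
    by_contra h
    have := hw i h
    simp [hi] at this
  have hminus : ∀ j ∈ idxMinus ℓ x y p k, inner ℝ w (x j) ≠ 0 := by
    intro j hj hj0
    let V := Submodule.span ℝ (x '' (idxPos ℓ x y p k : Set (Fin N)))
    -- Testing with `±v` kills the positive weights, while the span condition and `x j ≠ 0` keep `x
    -- j` outside `V`, so the term at `j` is strictly negative.
    obtain ⟨v, hvV, hv, -⟩ := exists_generic_perturbation x Vᗮ (zero_mem _)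
    rw [Submodule.orthogonal_orthogonal] at hv
    have hvj : inner ℝ v (x j) ≠ 0 := by
      rw [real_inner_comm]
      refine hv j fun hjV => hx j ?_
      have : x j ∈ V ⊓ Submodule.span ℝ (x '' (idxMinus ℓ x y p k : Set (Fin N))) :=
        ⟨hjV, Submodule.subset_span ⟨j, hj, rfl⟩⟩
      rwa [hq k, Submodule.mem_bot] at this
    have hsum : 0 ≤ ∑ i, (p k).fst * rho ℓ x y p i *
        (if inner ℝ w (x i) = 0 then |inner ℝ v (x i)| else 0) := by
      have h1 := add_le_add (hle v) (hle (-v))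
      rw [inner_neg_right, add_neg_cancel, ← Finset.sum_add_distrib] at h1
      refine h1.trans (le_of_eq (Finset.sum_congr rfl fun i _ => ?_))
      rw [← mul_add, inner_neg_left, reluDir_add_reluDir_neg]
    refine hsum.not_gt (Finset.sum_neg' (fun i _ => ?_) ⟨j, Finset.mem_univ _, ?_⟩)
    · split_ifs with hi
      · rcases le_or_gt ((p k).fst * rho ℓ x y p i) 0 with h | h
        · exact mul_nonpos_of_nonpos_of_nonneg h (abs_nonneg _)
        · have hiV : x i ∈ V := Submodule.subset_span ⟨i, mem_idxPos.2 ⟨hw0 i hi, h⟩, rfl⟩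
          rw [real_inner_comm, hvV _ hiV]
          simp
      · simp
    · rw [if_pos hj0]
      exact mul_neg_of_neg_of_pos (mem_idxMinus.1 hj).2 (abs_pos.2 hvj)
  have hnonneg : ∀ i, inner ℝ w (x i) = 0 → 0 ≤ (p k).fst * rho ℓ x y p i := fun i hi => by
    by_contra h
    exact hminus i (mem_idxMinus.2 ⟨hw0 i hi, not_le.1 h⟩) hi
  -- The terms off the kinks of `w` are linear and are subtracted; the rest is a support function
  -- with nonnegative weights.
  obtain ⟨ξ, hξ, hξs⟩ := exists_zonotope_coeff
    (fun i => (if inner ℝ w (x i) = 0 then (p k).fst * rho ℓ x y p i else 0) • x i)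
    ((s k).snd - ∑ i, (if inner ℝ w (x i) = 0 then 0 else
      (p k).fst * rho ℓ x y p i * (if 0 < inner ℝ w (x i) then 1 else 0)) • x i) (by
      intro v
      rw [inner_sub_left, sub_le_iff_le_add, sum_inner, ← Finset.sum_add_distrib]
      refine (hle v).trans (le_of_eq (Finset.sum_congr rfl fun i _ => ?_))
      rw [real_inner_smul_left, real_inner_smul_left, real_inner_comm v (x i)]
      by_cases hi : inner ℝ w (x i) = 0
      · rw [hi, reluDir_zero_left]
        simp [mul_max_of_nonneg _ _ (hnonneg i hi)]
      · rw [reluDir_of_ne hi]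
        simp [hi])
  refine mem_limitingG_iff.2 ⟨fun i => if inner ℝ w (x i) = 0 then ξ i else
    (if 0 < inner ℝ w (x i) then 1 else 0), w, ?_, ?_, ?_, ?_⟩
  · intro i hi
    have h1 := hw i hi
    have h2 : inner ℝ w (x i) ≠ 0 := fun h => hi (hw0 i h)
    simp only [h2, if_false]
    rcases pos_and_pos_or_neg_and_neg_of_mul_pos h1 with h | h
    · simp [h.1, h.2]
    · simp [h.1.le.not_gt, h.2.le.not_gt]
  · intro i _
    dsimp only
    split_ifs
    · exact hξ i
    all_goals simp
  · intro i hi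
    exact ⟨hminus i hi, by simp [hminus i hi]⟩
  · rw [sub_eq_iff_eq_add, ← Finset.sum_add_distrib] at hξs
    rw [hξs]
    refine Finset.sum_congr rfl fun i _ => ?_
    by_cases hi : inner ℝ w (x i) = 0
    · simp [hi, smul_smul, mul_comm]
    · simp [hi]

/-- A direction that realizes a given activation pattern on `I_k^-` while staying on the kinks
of `I_k^{>}`, and leaving every kink outside the span of the latter. -/
theorem exists_direction_of_activeSpanQual (hq : ActiveSpanQual ℓ x y p) (k : Fin H)
    (v : EuclideanSpace ℝ (Fin d)) :
    ∃ v' : EuclideanSpace ℝ (Fin d),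
      (∀ i ∈ idxPos ℓ x y p k, inner ℝ v' (x i) = 0) ∧
      (∀ i ∈ idxMinus ℓ x y p k, inner ℝ v (x i) ≠ 0 →
        0 < inner ℝ v (x i) * inner ℝ v' (x i)) ∧
      ∀ i, inner ℝ v' (x i) = 0 →
        x i ∈ Submodule.span ℝ (x '' (idxPos ℓ x y p k : Set (Fin N))) := by
  have htop := orthogonal_sup_orthogonal_eq_top (hq k)
  have hv : v ∈ (⊤ : Submodule ℝ (EuclideanSpace ℝ (Fin d))) := Submodule.mem_top
  rw [← htop] at hv
  obtain ⟨m, hm, n, hn, rfl⟩ := Submodule.mem_sup.1 hv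
  obtain ⟨v', hv', hgen, hsign⟩ := exists_generic_perturbation x _ hm
  rw [Submodule.orthogonal_orthogonal] at hgen
  refine ⟨v', fun i hi => ?_, fun i hi hne => ?_, fun i hi => ?_⟩
  · rw [real_inner_comm]
    exact hv' _ (Submodule.subset_span ⟨i, hi, rfl⟩)
  · have hni : inner ℝ n (x i) = 0 := by
      rw [real_inner_comm]
      exact hn _ (Submodule.subset_span ⟨i, hi, rfl⟩)
    rw [inner_add_left, hni, add_zero] at hne ⊢
    have := hsign i (by rwa [real_inner_comm])
    rwa [real_inner_comm, real_inner_comm v'] at this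
  · by_contra h
    exact hgen i h (by rwa [real_inner_comm])

theorem tendsto_params {α : Type*} {l : Filter α} (f : α → Fin H → ℝ)
    (g : α → Fin H → EuclideanSpace ℝ (Fin d)) (q : Params H d)
    (hf : ∀ k, Tendsto (fun t => f t k) l (𝓝 (q k).fst))
    (hg : ∀ k, Tendsto (fun t => g t k) l (𝓝 (q k).snd)) :
    Tendsto (fun t => (WithLp.toLp 2 fun k => WithLp.toLp 2 (f t k, g t k) : Params H d)) l
      (𝓝 q) := by
  have h : Tendsto (fun t k => WithLp.toLp 2 (f t k, g t k)) l (𝓝 q.ofLp) := by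
    rw [tendsto_pi_nhds]
    intro k
    exact ((WithLp.prod_continuous_toLp 2 _ _).tendsto _).comp ((hf k).prodMk_nhds (hg k))
  exact ((PiLp.continuous_toLp 2 _).tendsto _).comp h

theorem chainSet_subset_limitingSubdiff (hℓ : ContDiff ℝ 1 (fun q : ℝ × ℝ => ℓ q.1 q.2))
    (hq : ActiveSpanQual ℓ x y p) :
    chainSet ℓ x y p ⊆ limitingSubdiff (empLoss ℓ x y) p := by
  classical
  intro s hs
  have hs2 := fun k => mem_limitingG_iff.1 (hs k).2
  choose c v hoff hplus hminus hsum using hs2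
  choose v' hv'pos hv'minus hv'span using fun k =>
    exists_direction_of_activeSpanQual hq k (v k)
  -- Only the `w_k` move, along directions that keep the kinks of `I_k^>` and leave those of `I_k^-`
  -- on the prescribed sides.
  let z : ℝ → Params H d := fun t =>
    WithLp.toLp 2 fun k => WithLp.toLp 2 ((p k).fst, (p k).snd + t • v' k)
  have hzsnd : ∀ k, Tendsto (fun t : ℝ => (p k).snd + t • v' k) (𝓝[>] 0) (𝓝 (p k).snd) := by
    intro k
    have : Continuous fun t : ℝ => (p k).snd + t • v' k := by fun_prop
    simpa using (this.tendsto 0).mono_left nhdsWithin_le_nhds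
  have hz : Tendsto z (𝓝[>] 0) (𝓝 p) :=
    tendsto_params (fun _ k => (p k).fst) _ p (fun k => tendsto_const_nhds) hzsnd
  have hrho : ∀ i, Tendsto (fun t => rho ℓ x y (z t) i) (𝓝[>] 0) (𝓝 (rho ℓ x y p i)) :=
    fun i => ((continuous_rho x y hℓ i).tendsto p).comp hz
  let T : Fin H → Finset (Fin N) := fun k => Finset.univ.filter fun i =>
    inner ℝ (p k).snd (x i) = 0 ∧ inner ℝ (v' k) (x i) = 0
  have hT : ∀ k i, i ∈ T k ↔ inner ℝ (p k).snd (x i) = 0 ∧ inner ℝ (v' k) (x i) = 0 :=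
    fun k i => by simp [T]
  have hPT : ∀ k, idxPos ℓ x y p k ⊆ T k := fun k i hi =>
    (hT k i).2 ⟨(mem_idxPos.1 hi).1, hv'pos k i hi⟩
  have hTP : ∀ k, ∀ i ∈ T k, i ∉ idxPos ℓ x y p k → (p k).fst * rho ℓ x y p i = 0 := by
    intro k i hi hiP
    obtain ⟨h1, h2⟩ := (hT k i).1 hi
    rcases lt_trichotomy ((p k).fst * rho ℓ x y p i) 0 with h | h | h
    · have h3 := mem_idxMinus.2 ⟨h1, h⟩
      have := hv'minus k i h3 (hminus k i h3).1
      simp [h2] at this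
    · exact h
    · exact absurd (mem_idxPos.2 ⟨h1, h⟩) hiP
  have hsub := fun k => exists_tendsto_subgradient (l := 𝓝[>] (0 : ℝ)) (T k) x
    (fun t i => (p k).fst * rho ℓ x y (z t) i) (fun i => (p k).fst * rho ℓ x y p i) (c k)
    (fun i _ => (hrho i).const_mul _) (idxPos ℓ x y p k) (hPT k)
    (fun i hi => hplus k i (mem_idxPlus.2 ⟨(mem_idxPos.1 hi).1, (mem_idxPos.1 hi).2.le⟩))
    (fun i hi => (mem_idxPos.1 hi).2) (hTP k) (fun i hi => hv'span k i ((hT k i).1 hi).2)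
  choose r hr hrle using hsub
  let e : Fin H → Fin N → ℝ := fun k i => if inner ℝ (p k).snd (x i) = 0 then
    (if 0 < inner ℝ (v' k) (x i) then 1 else 0) else
    (if 0 < inner ℝ (p k).snd (x i) then 1 else 0)
  -- On kinks left by the path, the new activation may differ from `c`, but only where the weight
  -- vanishes.
  have hec : ∀ k, ∀ i ∈ (T k)ᶜ, (p k).fst * rho ℓ x y p i * e k i =
      (p k).fst * rho ℓ x y p i * c k i := by
    intro k i hi
    rw [Finset.mem_compl, hT, not_and] at hi
    by_cases h0 : inner ℝ (p k).snd (x i) = 0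
    · have h1 := hi h0
      rcases lt_trichotomy ((p k).fst * rho ℓ x y p i) 0 with h | h | h
      · have h3 := mem_idxMinus.2 ⟨h0, h⟩
        have h4 := hv'minus k i h3 (hminus k i h3).1
        rw [(hminus k i h3).2]
        simp only [e, h0, if_true]
        rcases pos_and_pos_or_neg_and_neg_of_mul_pos h4 with h5 | h5
        · simp [h5.1, h5.2]
        · simp [h5.1.le.not_gt, h5.2.le.not_gt]
      · simp [h]
      · exact absurd (hv'pos k i (mem_idxPos.2 ⟨h0, h⟩)) h1
    · rw [hoff k i h0]
      simp [e, h0]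
  have hdir : ∀ᶠ t in 𝓝[>] (0 : ℝ), ∀ k i, ∀ q, reluDir (inner ℝ (z t k).snd (x i)) q =
      if i ∈ T k then max q 0 else e k i * q := by
    rw [eventually_all]
    intro k
    rw [eventually_all]
    intro i
    have hzin : ∀ t, inner ℝ (z t k).snd (x i) =
        inner ℝ (p k).snd (x i) + t * inner ℝ (v' k) (x i) := fun t => by
      simp [z, inner_add_left, real_inner_smul_left]
    by_cases h0 : inner ℝ (p k).snd (x i) = 0
    · filter_upwards [self_mem_nhdsWithin] with t (ht : 0 < t) q
      rw [hzin, h0, zero_add]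
      by_cases h1 : inner ℝ (v' k) (x i) = 0
      · rw [if_pos ((hT k i).2 ⟨h0, h1⟩), h1, mul_zero, reluDir_zero_left]
      · rw [if_neg (fun h => h1 ((hT k i).1 h).2), reluDir_of_ne (mul_ne_zero ht.ne' h1)]
        simp [e, h0, mul_pos_iff_of_pos_left ht]
    · have hlim : Tendsto (fun t => inner ℝ (z t k).snd (x i)) (𝓝[>] 0)
          (𝓝 (inner ℝ (p k).snd (x i))) := (hzsnd k).inner tendsto_const_nhds
      filter_upwards [(hlim.const_mul (inner ℝ (p k).snd (x i))).eventually_const_lt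
        (mul_self_pos.2 h0)] with t ht q
      rw [if_neg (fun h => h0 ((hT k i).1 h).1)]
      have hne : inner ℝ (z t k).snd (x i) ≠ 0 := fun h => by simp [h] at ht
      rw [reluDir_of_ne hne]
      rcases pos_and_pos_or_neg_and_neg_of_mul_pos ht with h5 | h5
      · simp [e, h5.1, h5.2, h0]
      · simp [e, h5.1.le.not_gt, h5.2.le.not_gt, h0]
  refine mem_limitingSubdiff_of_tendsto (l := 𝓝[>] (0 : ℝ)) z
    (fun t => WithLp.toLp 2 fun k => WithLp.toLp 2
      (∑ i, rho ℓ x y (z t) i * max (inner ℝ (z t k).snd (x i)) 0,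
       ∑ i ∈ (T k)ᶜ, ((p k).fst * rho ℓ x y (z t) i * e k i) • x i + r k t)) hz
    (tendsto_params _ _ s (fun k => ?_) fun k => ?_) ?_
  · rw [(hs k).1]
    exact tendsto_finsetSum _ fun i _ =>
      (hrho i).mul (((hzsnd k).inner tendsto_const_nhds).max tendsto_const_nhds)
  · rw [hsum k, ← Finset.sum_compl_add_sum (T k)]
    refine Tendsto.add (tendsto_finsetSum _ fun i hi => ?_) (hr k)
    rw [← hec k i hi]
    exact (((hrho i).const_mul _).mul_const _).smul_const _
  · filter_upwards [hdir, eventually_all.2 hrle] with t ht hrt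
    rw [mem_frechetSubdiff_empLoss_iff x y hℓ]
    refine fun k => ⟨rfl, fun u => ?_⟩
    rw [← Finset.sum_compl_add_sum (T k)]
    change inner ℝ (∑ i ∈ (T k)ᶜ, ((p k).fst * rho ℓ x y (z t) i * e k i) • x i + r k t) u ≤ _
    rw [inner_add_left, sum_inner]
    refine add_le_add (le_of_eq (Finset.sum_congr rfl fun i hi => ?_))
      ((hrt k u).trans (le_of_eq (Finset.sum_congr rfl fun i hi => ?_)))
    · rw [ht k i, if_neg (Finset.mem_compl.1 hi), real_inner_smul_left, real_inner_comm (x i)]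
      change _ = (p k).fst * _ * _
      ring
    · rw [ht k i, if_pos hi]
      rfl

theorem activeSpanQual_of_chainSet_subset (hℓ : ContDiff ℝ 1 (fun q : ℝ × ℝ => ℓ q.1 q.2))
    (hx : ∀ i, x i ≠ 0) (hsub : chainSet ℓ x y p ⊆ limitingSubdiff (empLoss ℓ x y) p) :
    ActiveSpanQual ℓ x y p := by
  classical
  intro k
  by_contra hne
  rw [Set.image_eq_range, Set.image_eq_range] at hne
  obtain ⟨v₀, C, hC, heq, ⟨j, hj⟩, hj0⟩ := exists_sum_inner_smul_eq _ _ hne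
  -- The Gram identity holds at `v₀`, but `-v` must avoid every kink to be an admissible direction
  -- in `limitingG`; only the signs of `v₀` are carried over.
  obtain ⟨v, -, hgen, hsign⟩ := exists_generic_perturbation x ⊤ (v₀ := v₀) Submodule.mem_top
  have hv : ∀ i, inner ℝ v (x i) ≠ 0 := fun i => by
    rw [real_inner_comm]
    exact hgen i (by simpa using hx i)
  have hsign' : ∀ i, inner ℝ v₀ (x i) ≠ 0 → 0 < inner ℝ v₀ (x i) * inner ℝ v (x i) :=
    fun i hi => by
      have := hsign i (by rwa [real_inner_comm])
      rwa [real_inner_comm, real_inner_comm v] at this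
  -- Each multiplier makes its term against `v` as large as any nearby activation pattern could: the
  -- pattern of `v` for weights `≥ 0`, that of `-v` for negative ones.
  let c : Fin H → Fin N → ℝ := fun k i => if inner ℝ (p k).snd (x i) = 0 then
    (if 0 ≤ (p k).fst * rho ℓ x y p i then (if 0 < inner ℝ v (x i) then 1 else 0) else
      (if inner ℝ v (x i) < 0 then 1 else 0)) else
    (if 0 < inner ℝ (p k).snd (x i) then 1 else 0)
  let s : Params H d := WithLp.toLp 2 fun k => WithLp.toLp 2
    (∑ i, rho ℓ x y p i * max (inner ℝ (p k).snd (x i)) 0,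
     ∑ i, ((p k).fst * rho ℓ x y p i * c k i) • x i)
  have hs : s ∈ chainSet ℓ x y p := by
    refine fun k => ⟨rfl, mem_limitingG_iff.2 ⟨c k, -v, fun i hi => by simp [c, hi], ?_, ?_, rfl⟩⟩
    · intro i _
      simp only [c]
      split_ifs <;> simp
    · intro i hi
      obtain ⟨h1, h2⟩ := mem_idxMinus.1 hi
      refine ⟨by simpa using hv i, ?_⟩
      simp [c, h1, h2.not_ge]
  obtain ⟨-, w, hw, hle⟩ := exists_weight_of_mem_limitingSubdiff hℓ (hsub hs) k
  have hterm : ∀ i ∈ Finset.univ, (p k).fst * rho ℓ x y p i *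
      reluDir (inner ℝ w (x i)) (inner ℝ v (x i)) ≤
      (p k).fst * rho ℓ x y p i * (c k i * inner ℝ v (x i)) := by
    intro i _
    by_cases h0 : inner ℝ (p k).snd (x i) = 0
    · rcases le_or_gt 0 ((p k).fst * rho ℓ x y p i) with h | h
      · refine mul_le_mul_of_nonneg_left ((reluDir_le_max _ _).trans (le_of_eq ?_)) h
        simp only [c, h0, h, if_true]
        split_ifs with h1
        · simp [h1.le]
        · simp [not_lt.1 h1]
      · refine mul_le_mul_of_nonpos_left ((le_of_eq ?_).trans (min_le_reluDir _ _)) h.le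
        simp only [c, h0, h.not_ge, if_true, if_false]
        split_ifs with h1
        · simp [h1.le]
        · simp [not_lt.1 h1]
    · have h1 := hw i h0
      have h2 : inner ℝ w (x i) ≠ 0 := fun h => by simp [h] at h1
      rw [reluDir_of_ne h2]
      refine le_of_eq ?_
      rcases pos_and_pos_or_neg_and_neg_of_mul_pos h1 with h5 | h5
      · simp [c, h5.1, h5.2, h0]
      · simp [c, h5.1.le.not_gt, h5.2.le.not_gt, h0]
  have hinner : inner ℝ (s k).snd v =
      ∑ i, (p k).fst * rho ℓ x y p i * (c k i * inner ℝ v (x i)) := by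
    change inner ℝ (∑ i, ((p k).fst * rho ℓ x y p i * c k i) • x i) v = _
    rw [sum_inner]
    refine Finset.sum_congr rfl fun i _ => ?_
    rw [real_inner_smul_left, real_inner_comm v, mul_assoc]
  -- The subgradient inequality at `v` reverses the termwise bound, so every term is an equality,
  -- and this determines the signs of `w`.
  have hall := (Finset.sum_eq_sum_iff_of_le hterm).1
    (le_antisymm (Finset.sum_le_sum hterm) (hinner ▸ hle v))
  have hpos : ∀ i ∈ idxPos ℓ x y p k, 0 ≤ inner ℝ v (x i) * inner ℝ w (x i) := by
    intro i hi
    obtain ⟨h0, h1⟩ := mem_idxPos.1 hi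
    have h2 := mul_left_cancel₀ h1.ne' (hall i (Finset.mem_univ i))
    simp only [c, h0, h1.le, if_true] at h2
    by_contra! hlt
    rcases mul_neg_iff.1 hlt with h3 | h3
    · rw [reluDir_of_neg h3.2] at h2
      simp [h3.1, h3.1.ne] at h2
    · rw [reluDir_of_pos h3.2] at h2
      simp [h3.1.le.not_gt, h3.1.ne] at h2
  have hneg : ∀ i ∈ idxMinus ℓ x y p k, inner ℝ v (x i) * inner ℝ w (x i) < 0 := by
    intro i hi
    obtain ⟨h0, h1⟩ := mem_idxMinus.1 hi
    have h2 := mul_left_cancel₀ h1.ne (hall i (Finset.mem_univ i))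
    simp only [c, h0, h1.not_ge, if_true, if_false] at h2
    rcases lt_trichotomy (inner ℝ w (x i)) 0 with h3 | h3 | h3
    · rw [reluDir_of_neg h3] at h2
      rcases (hv i).lt_or_gt with h4 | h4
      · simp [h4, h4.ne'] at h2
      · exact mul_neg_of_pos_of_neg h4 h3
    · rw [h3, reluDir_zero_left] at h2
      rcases (hv i).lt_or_gt with h4 | h4
      · simp [h4, h4.le, h4.ne'] at h2
      · simp [h4.le, h4.le.not_gt, h4.ne'] at h2
    · rw [reluDir_of_pos h3] at h2
      rcases (hv i).lt_or_gt with h4 | h4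
      · exact mul_neg_of_neg_of_pos h4 h3
      · simp [h4.le.not_gt, h4.ne'] at h2
  have heq' := congrArg (fun u => inner ℝ u w) heq
  simp only [sum_inner, real_inner_smul_left] at heq'
  have hprod : ∀ i, inner ℝ v (x i) * inner ℝ v (x i) * (inner ℝ v₀ (x i) * inner ℝ w (x i)) =
      inner ℝ v₀ (x i) * inner ℝ v (x i) * (inner ℝ v (x i) * inner ℝ w (x i)) :=
    fun i => by ring
  have hminus : ∀ i ∈ idxMinus ℓ x y p k, inner ℝ v₀ (x i) ≠ 0 →
      inner ℝ v₀ (x i) * inner ℝ w (x i) < 0 := by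
    intro i hi h0
    by_contra! hge
    have h1 := mul_nonneg (mul_self_nonneg (inner ℝ v (x i))) hge
    rw [hprod] at h1
    exact h1.not_gt (mul_neg_of_pos_of_neg (hsign' i h0) (hneg i hi))
  -- Paired with `w`, the `I_k^>` side is nonnegative, whereas the `I_k^-` side is negative because
  -- of the index `j`.
  refine absurd heq' (ne_of_gt (lt_of_lt_of_le (mul_neg_of_pos_of_neg hC
    (Finset.sum_neg' (fun i _ => ?_) ⟨⟨j, hj⟩, Finset.mem_univ _, ?_⟩))
    (Finset.sum_nonneg fun i _ => ?_)))
  · rw [real_inner_comm w]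
    by_cases h0 : inner ℝ v₀ (x i) = 0
    · simp [h0]
    · exact (hminus i i.2 h0).le
  · rw [real_inner_comm w]
    exact hminus j hj hj0
  · rw [real_inner_comm w]
    by_cases h0 : inner ℝ v₀ (x i) = 0
    · simp [h0]
    · refine (mul_nonneg_iff_of_pos_left (mul_self_pos.2 (hv i))).1 ?_
      rw [hprod]
      exact mul_nonneg (hsign' i h0).le (hpos i i.2)

end ChainRule

theorem theorem3 {H d N : ℕ} (ℓ : ℝ → ℝ → ℝ)
    (hℓ : ContDiff ℝ 1 (fun q : ℝ × ℝ => ℓ q.1 q.2))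
    (hℓ' : LocallyLipschitz (fderiv ℝ (fun q : ℝ × ℝ => ℓ q.1 q.2)))
    (x : Fin N → EuclideanSpace ℝ (Fin d)) (hx : ∀ i, x i ≠ 0) (y : Fin N → ℝ)
    (p : Params H d) :
    (LimitingChainRule ℓ x y p ↔ ActiveSpanQual ℓ x y p) ∧
    (SpanQual ℓ x y p → LimitingChainRule ℓ x y p) ∧
    ((∀ k i, (p k).fst ≠ 0 → inner ℝ (p k).snd (x i) = 0 → rho ℓ x y p i ≠ 0) →
      (LimitingChainRule ℓ x y p ↔ SpanQual ℓ x y p)) := by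
  have hiff : LimitingChainRule ℓ x y p ↔ ActiveSpanQual ℓ x y p :=
    ⟨fun h => activeSpanQual_of_chainSet_subset hℓ hx h.symm.subset, fun h =>
      (limitingSubdiff_subset_chainSet hℓ hx h).antisymm (chainSet_subset_limitingSubdiff hℓ h)⟩
  have hmono : SpanQual ℓ x y p → ActiveSpanQual ℓ x y p := by
    intro h k
    refine eq_bot_iff.2 ((inf_le_inf_right _ (Submodule.span_mono (Set.image_mono ?_))).trans
      (h k).le)
    exact fun i hi => mem_idxPlus.2 ⟨(mem_idxPos.1 hi).1, (mem_idxPos.1 hi).2.le⟩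
  refine ⟨hiff, fun h => hiff.2 (hmono h), fun hρ => hiff.trans ⟨fun h k => ?_, hmono⟩⟩
  -- If `u_k = 0`, then `I_k^-` is empty and the condition is void; otherwise no kink has zero
  -- weight, so `I_k^+` and `I_k^>` coincide.
  by_cases hu : (p k).fst = 0
  · have : idxMinus ℓ x y p k = ∅ := by
      ext i
      simp [mem_idxMinus, hu]
    simp [this]
  · have : idxPlus ℓ x y p k = idxPos ℓ x y p k := by
      ext i
      rw [mem_idxPlus, mem_idxPos]
      refine and_congr_right fun hi => ⟨fun h => h.lt_of_ne ?_, le_of_lt⟩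
      exact (mul_ne_zero hu (hρ k i hu hi)).symm
    rw [this]
    exact h k
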